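/- Let $k$ be a field and let $Sm/k$ be the category of smooth separated $k$-schemes (the statement holds both for all of them and for those of finite type over $k$), with the Nisnevich topology: a sieve on $X$ is covering if it contains a family of étale morphisms $f_i : U_i \to X$ such that for every $x \in X$ there are an index $i$ and a point $u \in U_i$ with $f_i(u) = x$ and $\kappa(x) \to \kappa(u)$ an isomorphism. Let $\mathbb{G}_m$ be the presheaf $X \mapsto \mathcal{O}(X)^\times$ on $Sm/k$ and let $\mathbb{Z}[\mathbb{G}_m]$ be the free presheaf of abelian groups generated by $\mathbb{G}_m$, i.e. $\mathbb{Z}[\mathbb{G}_m](X)$ is the free abelian group on the set $\mathbb{G}_m(X)$. Let $\mathcal{F}$ be the presheaf of abelian groups on $Sm/k$ which associates to every $X = \coprod_i X_i$, where the $X_i$ are the connected components of $X$, the group $\prod_i \mathbb{Z}[\mathbb{G}_m](X_i)$; for a morphism $f : Y \to X$, a family $(s_i)_i$ is restricted to the family whose entry at a connected component $Y_j$ of $Y$ is the pullback to $Y_j$ of $s_i$, where $X_i$ is the component of $X$ containing $f(Y_j)$. Then $\mathcal{F}$, together with the morphism $\mathbb{Z}[\mathbb{G}_m] \to \mathcal{F}$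 given by restriction to the connected components, is the Nisnevich sheafification $a_{Nis}(\mathbb{Z}[\mathbb{G}_m])$. That is, $\mathcal{F}$ is a Nisnevich sheaf, and every morphism from $\mathbb{Z}[\mathbb{G}_m]$ to a Nisnevich sheaf of abelian groups on $Sm/k$ factors uniquely through $\mathbb{Z}[\mathbb{G}_m] \to \mathcal{F}$. -/

import Mathlib

open CategoryTheory AlgebraicGeometry Opposite

universe u

/-! ### Connected components of locally Noetherian schemes are open -/

lemma exists_nhds_isPreconnected_of_noetherianSpace {Y : Type*} [TopologicalSpace Y]
    [TopologicalSpace.NoetherianSpace Y] (x : Y) : ∃ V ∈ nhds x, IsPreconnected V := by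
  have hfin := TopologicalSpace.NoetherianSpace.finite_irreducibleComponents (α := Y)
  refine ⟨⋃₀ {Z | Z ∈ irreducibleComponents Y ∧ x ∈ Z}, ?_, ?_⟩
  · have hcl : IsClosed (⋃₀ {Z | Z ∈ irreducibleComponents Y ∧ x ∉ Z}) :=
      by
      rw [Set.sUnion_eq_biUnion]
      exact Set.Finite.isClosed_biUnion (hfin.subset fun Z hZ => hZ.1)
          fun Z hZ => isClosed_of_mem_irreducibleComponents Z hZ.1
    refine Filter.mem_of_superset (hcl.isOpen_compl.mem_nhds ?_) ?_
    · rintro ⟨Z, hZ, hxZ⟩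
      exact hZ.2 hxZ
    · intro y hy
      refine ⟨irreducibleComponent y, ⟨irreducibleComponent_mem_irreducibleComponents y, ?_⟩,
        mem_irreducibleComponent⟩
      by_contra hx
      exact hy ⟨_, ⟨irreducibleComponent_mem_irreducibleComponents y, hx⟩,
        mem_irreducibleComponent⟩
  · exact isPreconnected_sUnion x _ (fun Z hZ => hZ.2)
      fun Z hZ => hZ.1.1.isPreirreducible.isPreconnected

lemma locallyConnectedSpace_of_isLocallyNoetherian (X : Scheme.{u}) [IsLocallyNoetherian X] :
    LocallyConnectedSpace X := by
  rw [locallyConnectedSpace_iff_connected_subsets]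
  intro x N hN
  obtain ⟨_, ⟨W, hW, rfl⟩, hxW, hWN⟩ := X.isBasis_affineOpens.mem_nhds_iff.mp hN
  have : IsNoetherianRing Γ(X, W) := IsLocallyNoetherian.component_noetherian ⟨W, hW⟩
  have : TopologicalSpace.NoetherianSpace (W : Set X) := noetherianSpace_of_isAffineOpen W hW
  obtain ⟨V, hV, hVc⟩ := exists_nhds_isPreconnected_of_noetherianSpace
    (⟨x, hxW⟩ : (W : Set X))
  refine ⟨Subtype.val '' V, ?_, hVc.image _ continuous_subtype_val.continuousOn, ?_⟩
  · exact W.isOpen.isOpenEmbedding_subtypeVal.isOpenMap.image_mem_nhds hV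
  · rintro _ ⟨y, -, rfl⟩
    exact hWN y.2

/-! ### The category `Sm/k` -/

/-- Smooth separated morphisms; if `ft` holds, they are moreover required to be quasi-compact,
hence of finite type. -/
def smoothSeparated (ft : Prop) : MorphismProperty Scheme.{u} :=
  fun _ _ f => Smooth f ∧ IsSeparated f ∧ (ft → QuasiCompact f)

/-- The category `Sm/k` of smooth separated `k`-schemes and morphisms of `k`-schemes: all of them
if `ft` is false, those of finite type over `k` if `ft` is true. -/
abbrev Sm (k : Type u) [Field k] (ft : Prop) : Type (u + 1) :=
  (smoothSeparated.{u} ft).Over ⊤ (Spec (CommRingCat.of k))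

namespace Sm

variable {k : Type u} [Field k] {ft : Prop}

instance (X : Sm k ft) : Smooth X.hom := X.prop.1

instance (X : Sm k ft) : IsSeparated X.hom := X.prop.2.1

lemma isLocallyNoetherian (X : Sm k ft) : IsLocallyNoetherian X.left :=
  LocallyOfFiniteType.isLocallyNoetherian (Y := Spec (CommRingCat.of k)) X.hom

/-! ### The Nisnevich topology -/

/-- A sieve on `X` is a Nisnevich covering sieve if it contains a family of étale morphisms
`f : U ⟶ X` such that every point `x` of `X` is the image under some member `f` of the family of a
point `z` of `U` with `κ(x) ⟶ κ(z)` an isomorphism. -/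
def IsNisnevichCovering {X : Sm k ft} (S : Sieve X) : Prop :=
  ∀ x : X.left, ∃ (U : Sm k ft) (f : U ⟶ X) (z : U.left),
    S f ∧ Etale f.left ∧ f.left z = x ∧ IsIso (f.left.residueFieldMap z)

end Sm

lemma exists_pullback_point_isIso_residueFieldMap {X Y U : Scheme.{u}} (f : U ⟶ X) (g : Y ⟶ X)
    (z : U) (y : Y) (h : f z = g y) [IsIso (f.residueFieldMap z)] :
    ∃ w : ↥(Limits.pullback f g), Limits.pullback.snd f g w = y ∧
      IsIso ((Limits.pullback.snd f g).residueFieldMap w) := by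
  let φ : U.residueField z ⟶ Y.residueField y :=
    inv (f.residueFieldMap z) ≫ (X.residueFieldCongr h).hom ≫ g.residueFieldMap y
  have hφ : (Spec.map φ ≫ U.fromSpecResidueField z) ≫ f = Y.fromSpecResidueField y ≫ g := by
    rw [Category.assoc, ← Scheme.Hom.SpecMap_residueFieldMap_fromSpecResidueField,
      ← Scheme.Hom.SpecMap_residueFieldMap_fromSpecResidueField, ← Spec.map_comp_assoc]
    simp [φ]
  let l : Spec (CommRingCat.of (Y.residueField y)) ⟶ Limits.pullback f g :=
    Limits.pullback.lift _ _ hφ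
  let p := Scheme.SpecToEquivOfField (Y.residueField y) (Limits.pullback f g) l
  have hl : Spec.map p.2 ≫ (Limits.pullback f g).fromSpecResidueField p.1 = l :=
    (Scheme.SpecToEquivOfField (Y.residueField y) (Limits.pullback f g)).symm_apply_apply l
  have key : (⟨_, (Limits.pullback.snd f g).residueFieldMap p.1 ≫ p.2⟩ :
      Σ x : Y, Y.residueField x ⟶ .of (Y.residueField y)) = ⟨y, 𝟙 _⟩ := by
    apply (Scheme.SpecToEquivOfField (Y.residueField y) Y).symm.injective
    change Spec.map _ ≫ _ = Spec.map _ ≫ _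
    rw [Spec.map_comp, Category.assoc,
      Scheme.Hom.SpecMap_residueFieldMap_fromSpecResidueField, reassoc_of% hl]
    rw [Spec.map_id]
    exact (Limits.pullback.lift_snd _ _ _).trans (Category.id_comp _).symm
  obtain ⟨e, he⟩ := Scheme.SpecToEquivOfField_eq_iff.mp key
  refine ⟨p.1, e, ?_⟩
  have hiso : IsIso ((Limits.pullback.snd f g).residueFieldMap p.1 ≫ p.2) := by
    have : (Limits.pullback.snd f g).residueFieldMap p.1 ≫ p.2 =
      (Y.residueFieldCongr e).hom ≫ 𝟙 _ := he
    rw [this]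
    infer_instance
  rw [ConcreteCategory.isIso_iff_bijective] at hiso ⊢
  have h2 : Function.Injective p.2 := RingHom.injective p.2.hom
  refine ⟨RingHom.injective _, fun a => ?_⟩
  obtain ⟨b, hb⟩ := hiso.2 (p.2 a)
  exact ⟨b, h2 (by simpa using hb)⟩

namespace Sm

variable {k : Type u} [Field k] {ft : Prop}

lemma IsNisnevichCovering.pullback {X Y : Sm k ft} {S : Sieve X} (hS : IsNisnevichCovering S)
    (g : Y ⟶ X) : IsNisnevichCovering (S.pullback g) := by
  intro y
  obtain ⟨U, f, z, hf, hfe, hz, hi⟩ := hS (g.left y)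
  obtain ⟨w, hw, hwi⟩ := exists_pullback_point_isIso_residueFieldMap f.left g.left z y hz
  have hsep : IsSeparated f.left := by
    have : IsSeparated (f.left ≫ X.hom) := by
      rw [MorphismProperty.Over.w]; infer_instance
    exact IsSeparated.of_comp f.left X.hom
  have hqc : ft → QuasiCompact f.left := fun h => by
    have : QuasiCompact (f.left ≫ X.hom) := by
      rw [MorphismProperty.Over.w]; exact U.prop.2.2 h
    exact QuasiCompact.of_comp f.left X.hom
  let P : Sm k ft := MorphismProperty.Over.mk ⊤ (Limits.pullback.snd f.left g.left ≫ Y.hom)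
    ⟨inferInstance, inferInstance, fun h => by
      have := hqc h
      have : QuasiCompact Y.hom := Y.prop.2.2 h
      infer_instance⟩
  refine ⟨P, MorphismProperty.Over.homMk (Limits.pullback.snd f.left g.left) rfl trivial, w,
    ?_, ?_, hw, hwi⟩
  · have : (MorphismProperty.Over.homMk (Limits.pullback.snd f.left g.left) rfl trivial :
        P ⟶ Y) ≫ g =
        (MorphismProperty.Over.homMk (Limits.pullback.fst f.left g.left)
          (by
            change _ = Limits.pullback.snd f.left g.left ≫ Y.hom
            calc _ = Limits.pullback.fst f.left g.left ≫ f.left ≫ X.hom := by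
                  rw [MorphismProperty.Over.w f]; rfl
              _ = Limits.pullback.snd f.left g.left ≫ g.left ≫ X.hom := by
                  rw [Limits.pullback.condition_assoc]
              _ = _ := by rw [MorphismProperty.Over.w g]) trivial : P ⟶ U) ≫ f := by
      ext1
      exact Limits.pullback.condition.symm
    rw [Sieve.pullback_apply, this]
    exact S.downward_closed hf _
  · change Etale (Limits.pullback.snd f.left g.left)
    infer_instance

variable (k ft) in
/-- The Nisnevich topology on `Sm/k`. -/
def nisnevichTopology : GrothendieckTopology (Sm k ft) where
  sieves _ := {S | IsNisnevichCovering S}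
  top_mem' X x := ⟨X, 𝟙 X, x, trivial, inferInstanceAs (Etale (𝟙 X.left)), rfl,
    inferInstanceAs (IsIso ((𝟙 X.left : X.left ⟶ X.left).residueFieldMap x))⟩
  pullback_stable' _ _ _ g hS := hS.pullback g
  transitive' X S hS R hR x := by
    obtain ⟨U, f, z, hf, hfe, rfl, hi⟩ := hS x
    obtain ⟨V, g, v, hg, hge, rfl, hgi⟩ := hR hf z
    refine ⟨V, g ≫ f, v, hg, inferInstanceAs (Etale (g.left ≫ f.left)), rfl, ?_⟩
    change IsIso ((g.left ≫ f.left).residueFieldMap v)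
    rw [Scheme.residueFieldMap_comp]
    exact @IsIso.comp_isIso _ _ _ _ _ _ _ hi hgi

/-! ### Connected components -/

lemma isOpen_component (X : Sm k ft) (c : _root_.ConnectedComponents X.left) :
    IsOpen (ConnectedComponents.mk ⁻¹' {c} : Set X.left) := by
  have := X.isLocallyNoetherian
  have := locallyConnectedSpace_of_isLocallyNoetherian X.left
  obtain ⟨x, rfl⟩ := ConnectedComponents.surjective_coe c
  rw [connectedComponents_preimage_singleton]
  exact isOpen_connectedComponent

/-- A connected component of `X`, as an open subset. -/
def componentOpens (X : Sm k ft) (c : _root_.ConnectedComponents X.left) : X.left.Opens :=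
  ⟨ConnectedComponents.mk ⁻¹' {c}, X.isOpen_component c⟩

/-- A connected component of `X`, as an open subscheme of `X`. -/
noncomputable def component (X : Sm k ft) (c : _root_.ConnectedComponents X.left) : Sm k ft :=
  MorphismProperty.Over.mk ⊤ ((X.componentOpens c).ι ≫ X.hom)
    ⟨inferInstance, inferInstance, fun h => by
      have := X.isLocallyNoetherian
      have : QuasiCompact X.hom := X.prop.2.2 h
      infer_instance⟩

/-- The inclusion of a connected component of `X`. -/
noncomputable def componentι (X : Sm k ft) (c : _root_.ConnectedComponents X.left) :
    X.component c ⟶ X :=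
  MorphismProperty.Over.homMk (X.componentOpens c).ι rfl trivial

/-- The map on connected components induced by a morphism `f : Y ⟶ X`. -/
def mapComponents {X Y : Sm k ft} (f : Y ⟶ X) :
    _root_.ConnectedComponents Y.left → _root_.ConnectedComponents X.left :=
  f.left.continuous.connectedComponentsMap

lemma componentOpens_le {X Y : Sm k ft} (f : Y ⟶ X) (d : _root_.ConnectedComponents Y.left) :
    Y.componentOpens d ≤ f.left ⁻¹ᵁ X.componentOpens (mapComponents f d) := by
  rintro y rfl
  rfl

/-- The restriction of `f : Y ⟶ X` to a morphism from a connected component of `Y` to the connected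
component of `X` into which `f` maps it. -/
noncomputable def componentMap {X Y : Sm k ft} (f : Y ⟶ X) (d : _root_.ConnectedComponents Y.left) :
    Y.component d ⟶ X.component (mapComponents f d) :=
  MorphismProperty.Over.homMk
    (f.left.resLE (X.componentOpens (mapComponents f d)) (Y.componentOpens d)
      (componentOpens_le f d))
    (by
      change _ ≫ (X.componentOpens _).ι ≫ X.hom = (Y.componentOpens d).ι ≫ Y.hom
      rw [Scheme.Hom.resLE_comp_ι_assoc, MorphismProperty.Over.w f]) trivial

@[simp]
lemma componentMap_ι {X Y : Sm k ft} (f : Y ⟶ X) (d : _root_.ConnectedComponents Y.left) :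
    componentMap f d ≫ X.componentι _ = Y.componentι d ≫ f := by
  ext1
  exact Scheme.Hom.resLE_comp_ι _ _

instance (X : Sm k ft) (c : _root_.ConnectedComponents X.left) : Mono (X.componentι c) where
  right_cancellation g h w := by
    ext1
    have : g.left ≫ (X.componentOpens c).ι = h.left ≫ (X.componentOpens c).ι :=
      congr($(w).left)
    exact (cancel_mono (X.componentOpens c).ι).mp this

/-! ### Componentwise sections of a presheaf -/

lemma map_component_congr (P : (Sm k ft)ᵒᵖ ⥤ AddCommGrpCat.{u}) {X Y : Sm k ft} (f : Y ⟶ X)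
    (s : ∀ c : _root_.ConnectedComponents X.left, P.obj (op (X.component c)))
    {c c' : _root_.ConnectedComponents X.left} (h : c = c')
    (a : Y ⟶ X.component c) (a' : Y ⟶ X.component c')
    (ha : a ≫ X.componentι c = f) (ha' : a' ≫ X.componentι c' = f) :
    P.map a.op (s c) = P.map a'.op (s c') := by
  subst h
  rw [(cancel_mono (X.componentι c)).mp (ha.trans ha'.symm)]

lemma componentwise_id (P : (Sm k ft)ᵒᵖ ⥤ AddCommGrpCat.{u}) {X : Sm k ft}
    (s : ∀ c : _root_.ConnectedComponents X.left, P.obj (op (X.component c)))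
    (d : _root_.ConnectedComponents X.left) :
    P.map (componentMap (𝟙 X) d).op (s (mapComponents (𝟙 X) d)) = s d := by
  have h : mapComponents (𝟙 X) d = d := by
    obtain ⟨x, rfl⟩ := ConnectedComponents.surjective_coe d
    rfl
  refine (map_component_congr P (X.componentι d) s h (componentMap (𝟙 X) d)
    (𝟙 (X.component d)) ((componentMap_ι (𝟙 X) d).trans (Category.comp_id _))
    (Category.id_comp _)).trans ?_
  rw [op_id, P.map_id, ConcreteCategory.id_apply]

lemma componentwise_comp (P : (Sm k ft)ᵒᵖ ⥤ AddCommGrpCat.{u}) {X Y Z : Sm k ft} (f : Y ⟶ X)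
    (g : Z ⟶ Y) (s : ∀ c : _root_.ConnectedComponents X.left, P.obj (op (X.component c)))
    (d : _root_.ConnectedComponents Z.left) :
    P.map (componentMap (g ≫ f) d).op (s (mapComponents (g ≫ f) d)) =
      P.map (componentMap g d).op
        (P.map (componentMap f (mapComponents g d)).op (s (mapComponents f (mapComponents g d)))) := by
  rw [← ConcreteCategory.comp_apply, ← P.map_comp, ← op_comp]
  have h : mapComponents (g ≫ f) d = mapComponents f (mapComponents g d) := by
    obtain ⟨x, rfl⟩ := ConnectedComponents.surjective_coe d
    rfl
  exact map_component_congr P (Z.componentι d ≫ g ≫ f) s h _ _ (componentMap_ι _ _)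
    (by rw [Category.assoc, componentMap_ι, ← Category.assoc, componentMap_ι, Category.assoc])

/-- The presheaf `X = ∐ Xᵢ ↦ ∏ P(Xᵢ)`, where the `Xᵢ` are the connected components of `X`.
For `f : Y ⟶ X`, a family `s` restricts to the family whose entry at a component `Yⱼ` of `Y` is
the restriction to `Yⱼ` of the entry of `s` at the component of `X` that contains `f(Yⱼ)`. -/
noncomputable def componentwise (P : (Sm k ft)ᵒᵖ ⥤ AddCommGrpCat.{u}) :
    (Sm k ft)ᵒᵖ ⥤ AddCommGrpCat.{u} where
  obj X := AddCommGrpCat.of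
    (∀ c : _root_.ConnectedComponents X.unop.left, P.obj (op (X.unop.component c)))
  map f := AddCommGrpCat.ofHom
    { toFun s d := P.map (componentMap f.unop d).op (s (mapComponents f.unop d))
      map_zero' := by ext d; simp
      map_add' s t := by ext d; simp }
  map_id X := by
    ext s
    exact componentwise_id P s _
  map_comp f g := by
    ext s
    exact componentwise_comp P f.unop g.unop s _

/-- The morphism `P(X) ⟶ ∏ P(Xᵢ)` given by restriction to the connected components `Xᵢ` of `X`. -/
noncomputable def toComponentwise (P : (Sm k ft)ᵒᵖ ⥤ AddCommGrpCat.{u}) : P ⟶ componentwise P where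
  app X := AddCommGrpCat.ofHom
    { toFun s c := P.map (X.unop.componentι c).op s
      map_zero' := by ext c; simp
      map_add' s t := by ext c; simp }
  naturality X Y f := by
    ext s
    funext d
    change P.map (Y.unop.componentι d).op (P.map f s) =
      P.map (componentMap f.unop d).op (P.map (X.unop.componentι _).op s)
    rw [← ConcreteCategory.comp_apply, ← ConcreteCategory.comp_apply, ← P.map_comp, ← P.map_comp,
      ← op_comp, componentMap_ι]
    rfl

/-! ### The presheaf `ℤ[𝔾ₘ]` -/

variable (k ft) in
/-- The presheaf of sets `𝔾ₘ`, with `𝔾ₘ(X)` the set of invertible regular functions on `X`. -/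
noncomputable def Gm : (Sm k ft)ᵒᵖ ⥤ Type u where
  obj X := (Γ(X.unop.left, ⊤))ˣ
  map f := ↾(Units.map f.unop.left.appTop.hom.toMonoidHom)
  map_id X := by
    ext a
    rfl
  map_comp f g := by
    ext a
    change (g.unop.left ≫ f.unop.left).appTop.hom _ = _
    rw [Scheme.Hom.comp_appTop]
    rfl

variable (k ft) in
/-- The free presheaf of abelian groups `ℤ[𝔾ₘ]` generated by `𝔾ₘ`: its value at `X` is the free
abelian group on the set `𝔾ₘ(X)`. -/
noncomputable def ZGm : (Sm k ft)ᵒᵖ ⥤ AddCommGrpCat.{u} :=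
  Gm k ft ⋙ AddCommGrpCat.free

end Sm

/-- `η : P ⟶ F` exhibits `F` as the sheafification of the presheaf of abelian groups `P`: `F` is a
sheaf and `η` is universal among morphisms from `P` to sheaves of abelian groups. -/
structure IsSheafification {C : Type*} [Category* C] (J : GrothendieckTopology C)
    {P F : Cᵒᵖ ⥤ AddCommGrpCat.{u}} (η : P ⟶ F) : Prop where
  isSheaf : Presheaf.IsSheaf J F
  existsUnique (S : Cᵒᵖ ⥤ AddCommGrpCat.{u}) (hS : Presheaf.IsSheaf J S) (φ : P ⟶ S) :
    ∃! ψ : F ⟶ S, η ≫ ψ = φ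

/-! The geometric input is that connected components of smooth `k`-schemes are integral. Locally
such a scheme is étale over affine space, and over a normal domain an étale algebra contains every
idempotent of its generic fibre. Since that fibre is a product of fields, the local rings are
domains (`Algebra.Smooth.isDomain_localization`).

Hence a componentwise section of `ℤ[𝔾ₘ]` is determined by its values in `ℤ[K(X_c)ˣ]` at the generic
points. Field-valued points lift along Nisnevich coverings (`IsNisnevichCovering.exists_lift`), so
`componentwise (ZGm k ft)` is separated.

For gluing, lift the generic point of `X_c` to the covering and evaluate the family there; étale
base change makes the value independent of the lift (`CompatibleFamily.ev_eq`). Near each point of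
`X_c`, the value becomes a formal sum of units on a connected étale `W_d`. As `K(X_c)ˣ → K(W_d)ˣ` is
injective, no terms cancel, so each unit in the support individually becomes regular on `W_d`.
Faithfully flat descent of local rings makes it regular on `X_c`, and the same holds for its inverse
(`exists_pullUnits_eq`).

The universal property is formal: the components of `X` form a covering with empty overlaps, so
every sheaf `S` satisfies `S ≅ componentwise S`, and morphisms from `P` to `S` extend componentwise.
-/

/-! ### Smooth algebras over a field are locally domains -/

open TensorProduct in
/-- In an étale algebra over an integrally closed domain, zero divisors are separated by
idempotents. -/
lemma Algebra.Etale.exists_isIdempotentElem_of_mul_eq_zero {R S : Type u} [CommRing R] [IsDomain R]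
    [IsIntegrallyClosed R] [CommRing S] [Algebra R S] [Algebra.Etale R S] {a b : S}
    (h : a * b = 0) : ∃ e : S, IsIdempotentElem e ∧ e * a = a ∧ e * b = 0 := by
  classical
  let K := FractionRing R
  let T := K ⊗[R] S
  -- `T` is étale over the field `K`, hence a finite product of fields `A i`; by flatness of `S`
  -- over `R`, it contains `S`.
  obtain ⟨I, hI, A, hA, hA', ε, -⟩ := (Algebra.Etale.iff_exists_algEquiv_prod K T).mp inferInstance
  let j : S →+* ∀ i, A i := (ε : T →+* ∀ i, A i).comp
    (Algebra.TensorProduct.includeRight : S →ₐ[R] T).toRingHom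
  have inj : Function.Injective j := ε.injective.comp
    (Algebra.TensorProduct.includeRight_injective (IsFractionRing.injective R K))
  let a' := j a
  let b' := j b
  have hab : a' * b' = 0 := by rw [← map_mul, h, map_zero]
  -- The indicator of the factors where `a'` is nonzero; on these `b'` must vanish. It remains to
  -- descend it to `S`.
  let e' : ∀ i, A i := fun i => if a' i = 0 then 0 else 1
  have he' : e' * e' = e' := by
    ext i
    simp only [e', Pi.mul_apply]
    split_ifs <;> simp
  have hea : e' * a' = a' := by
    ext i
    simp only [e', Pi.mul_apply]
    split_ifs with h0 <;> simp [h0]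
  have heb : e' * b' = 0 := by
    ext i
    have := congrFun hab i
    simp only [e', Pi.mul_apply, Pi.zero_apply, mul_eq_zero] at this ⊢
    split_ifs with h0
    · simp
    · exact .inr (this.resolve_left h0)
  let c := Algebra.TensorProduct.comm R K S
  let t : S ⊗[R] K := c (ε.symm e')
  have ht : t * t = t := by simp only [t, ← map_mul, he']
  have hint : IsIntegral S t :=
    ⟨Polynomial.X ^ 2 - Polynomial.X, by monicity!, by simp [pow_two, ht]⟩
  -- Integral closure commutes with smooth base change, so `t` comes from `S ⊗[R] integralClosure R
  -- K`; as `R` is integrally closed, this means from `S`.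
  obtain ⟨y, hy⟩ := (TensorProduct.toIntegralClosure_bijective_of_smooth
    (R := R) (S := S) (B := K)).2 ⟨t, hint⟩
  obtain ⟨e, he⟩ : ∃ e : S, (e ⊗ₜ 1 : S ⊗[R] K) = t := by
    have key : ∀ y : S ⊗[R] integralClosure R K, ∃ e : S,
        (e ⊗ₜ 1 : S ⊗[R] K) = (TensorProduct.toIntegralClosure R S K y : S ⊗[R] K) := by
      intro y
      induction y with
      | zero => exact ⟨0, by simp⟩
      | add x y hx hy =>
        obtain ⟨e, he⟩ := hx
        obtain ⟨f, hf⟩ := hy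
        exact ⟨e + f, by rw [map_add, add_tmul, he, hf]; rfl⟩
      | tmul s r =>
        obtain ⟨r, hr⟩ := r
        obtain ⟨r, rfl⟩ := IsIntegrallyClosed.isIntegral_iff.mp hr
        refine ⟨r • s, ?_⟩
        simp [TensorProduct.toIntegralClosure, Algebra.algebraMap_eq_smul_one, smul_tmul]
    obtain ⟨e, he⟩ := key y
    exact ⟨e, by rw [he, hy]⟩
  have hε : j e = e' := by
    change ε (1 ⊗ₜ e) = e'
    have : (1 ⊗ₜ e : K ⊗[R] S) = ε.symm e' := by
      apply c.injective
      simpa [c] using he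
    rw [this, AlgEquiv.apply_symm_apply]
  refine ⟨e, inj ?_, inj ?_, inj ?_⟩
  · rw [map_mul, hε, he']
  · rw [map_mul, hε, hea]
  · rw [map_mul, hε, heb, map_zero]

lemma IsLocalRing.eq_zero_or_eq_one_of_isIdempotentElem {B : Type*} [CommRing B] [IsLocalRing B]
    {e : B} (he : IsIdempotentElem e) : e = 0 ∨ e = 1 := by
  have h : e * (1 - e) = 0 := by rw [mul_sub, mul_one, he.eq, sub_self]
  rcases IsLocalRing.isUnit_or_isUnit_one_sub_self e with hu | hu
  · exact .inr (sub_eq_zero.mp (hu.mul_right_eq_zero.mp h)).symm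
  · exact .inl (hu.mul_left_eq_zero.mp h)

/-- The local rings of a smooth algebra over a field are domains. -/
lemma Algebra.Smooth.isDomain_localization {K S : Type u} [Field K] [CommRing S] [Algebra K S]
    [Algebra.Smooth K S] (q : Ideal S) [q.IsPrime] (B : Type*) [CommRing B] [Algebra S B]
    [IsLocalization.AtPrime B q] : IsDomain B := by
  have := IsLocalization.AtPrime.isLocalRing B q
  obtain ⟨f, hf, n, _, _, _⟩ :=
    Algebra.IsSmoothAt.exists_isStandardEtale_mvPolynomial (R := K) (p := q)
  let φ : Localization.Away f →+* B := IsLocalization.Away.lift (g := algebraMap S B) f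
    (IsLocalization.map_units B (⟨f, hf⟩ : q.primeCompl))
  have hφ (s : S) : φ (algebraMap _ _ s) = algebraMap S B s := IsLocalization.Away.lift_eq _ _ _
  have key (a b : S) (h : algebraMap S B a * algebraMap S B b = 0) :
      algebraMap S B a = 0 ∨ algebraMap S B b = 0 := by
    rw [← map_mul, IsLocalization.map_eq_zero_iff q.primeCompl] at h
    -- The product `a * b` vanishes only after multiplication by some `u` outside `q`, so the
    -- idempotent must separate `u * a` from `b`.
    obtain ⟨u, hu⟩ := h
    have h1 : algebraMap S (Localization.Away f) (u * a) *
        algebraMap S (Localization.Away f) b = 0 := by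
      rw [← map_mul, mul_assoc, hu, map_zero]
    obtain ⟨e, he, hea, heb⟩ := Algebra.Etale.exists_isIdempotentElem_of_mul_eq_zero
      (R := MvPolynomial (Fin n) K) h1
    have hua : algebraMap S B (u * a) = 0 → algebraMap S B a = 0 := fun h => by
      rw [map_mul] at h
      exact (IsLocalization.map_units B u).mul_right_eq_zero.mp h
    rcases IsLocalRing.eq_zero_or_eq_one_of_isIdempotentElem (e := φ e) (he.map φ) with h0 | h0
    · refine .inl (hua ?_)
      rw [← hφ, ← hea, map_mul, h0, zero_mul]
    · refine .inr ?_
      rw [← hφ, ← one_mul (φ _), ← h0, ← map_mul, heb, map_zero]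
  have : NoZeroDivisors B := ⟨fun {x y} h => by
    obtain ⟨⟨a, s⟩, hx⟩ := IsLocalization.surj q.primeCompl x
    obtain ⟨⟨b, t⟩, hy⟩ := IsLocalization.surj q.primeCompl y
    have := key a b (by rw [← hx, ← hy, mul_mul_mul_comm, h, zero_mul])
    rw [← hx, ← hy, (IsLocalization.map_units B s).mul_left_eq_zero,
      (IsLocalization.map_units B t).mul_left_eq_zero] at this
    exact this⟩
  exact NoZeroDivisors.to_isDomain B

/-! ### Connected smooth schemes over a field are integral -/

/-- If an irreducible open `N` meets a nonempty open `U`, then `N ∩ U` is dense in `N`, so `N ⊆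
closure U`. Thus `closure U` is clopen, and by connectedness `U` is dense. -/
lemma preirreducibleSpace_of_forall_exists_isOpen {X : Type*} [TopologicalSpace X]
    [PreconnectedSpace X] (h : ∀ x : X, ∃ U : Set X, IsOpen U ∧ x ∈ U ∧ IsPreirreducible U) :
    PreirreducibleSpace X := by
  have dense (U : Set X) (hU : IsOpen U) (hne : U.Nonempty) : Dense U := by
    rw [dense_iff_closure_eq]
    refine IsClopen.eq_univ ⟨isClosed_closure, ?_⟩ (hne.mono subset_closure)
    rw [isOpen_iff_mem_nhds]
    intro x hx
    obtain ⟨N, hN, hxN, hNi⟩ := h x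
    refine Filter.mem_of_superset (hN.mem_nhds hxN) fun y hy => ?_
    rw [mem_closure_iff]
    intro V hV hyV
    obtain ⟨z, hzN, hzU⟩ := mem_closure_iff.mp hx N hN hxN
    obtain ⟨w, -, hwV, hwU⟩ := hNi V U hV hU ⟨y, hy, hyV⟩ ⟨z, hzN, hzU⟩
    exact ⟨w, hwV, hwU⟩
  refine ⟨fun U V hU hV hUne hVne => ?_⟩
  simp only [Set.univ_inter] at *
  rw [Set.inter_comm]
  exact (dense V hV hVne).inter_open_nonempty U hU hUne |>.mono (by rw [Set.inter_comm])

/-- Each point has an affine neighbourhood whose ring embeds in the stalk, so that neighbourhood is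
integral; connectedness makes the local irreducibility global. -/
lemma AlgebraicGeometry.isIntegral_of_isDomain_stalk (X : Scheme.{u}) [ConnectedSpace X]
    [X.IsGermInjective] (h : ∀ x, IsDomain (X.presheaf.stalk x)) : IsIntegral X := by
  have hred : IsReduced X := by
    have (x : X) : _root_.IsReduced (X.presheaf.stalk x) := by
      have := h x
      infer_instance
    exact isReduced_of_isReduced_stalk X
  have : PreirreducibleSpace X := preirreducibleSpace_of_forall_exists_isOpen fun x => by
    obtain ⟨U, hxU, hU, hinj⟩ := X.exists_germ_injective x
    have := h x
    have : IsDomain Γ(X, U) := hinj.isDomain (X.presheaf.germ U x hxU).hom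
    refine ⟨U, U.isOpen, hxU, ?_⟩
    have := (affine_isIntegral_iff Γ(X, U)).mpr ‹_›
    have : Nonempty (U : Scheme) := ⟨⟨x, hxU⟩⟩
    have : IsIntegral (U : Scheme) := isIntegral_of_isOpenImmersion hU.isoSpec.hom
    exact (isIrreducible_iff_irreducibleSpace.mpr
      (inferInstanceAs (IrreducibleSpace (U : Scheme)))).isPreirreducible
  have : IrreducibleSpace X := ⟨inferInstance⟩
  exact isIntegral_of_irreducibleSpace_of_isReduced X

lemma AlgebraicGeometry.Smooth.isDomain_stalk {k : Type u} [Field k] {X : Scheme.{u}}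
    (f : X ⟶ Spec (CommRingCat.of k)) [Smooth f] (x : X) : IsDomain (X.presheaf.stalk x) := by
  obtain ⟨_, ⟨V, hV, rfl⟩, hxV, -⟩ := X.isBasis_affineOpens.exists_subset_of_mem_open
    (Set.mem_univ x) isOpen_univ
  have hs := f.smooth_appLE (isAffineOpen_top _) hV le_top
  let g : k →+* Γ(X, V) := (f.appLE ⊤ V le_top).hom.comp
    (Scheme.ΓSpecIso (CommRingCat.of k)).inv.hom
  have hg : g.Smooth := RingHom.Smooth.respectsIso.2 _
    (Scheme.ΓSpecIso (CommRingCat.of k)).symm.commRingCatIsoToRingEquiv hs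
  algebraize [g]
  let := (X.presheaf.germ V x hxV).hom.toAlgebra
  have := hV.isLocalization_stalk ⟨x, hxV⟩
  exact Algebra.Smooth.isDomain_localization (K := k) (hV.primeIdealOf ⟨x, hxV⟩).asIdeal _

namespace Sm

variable {k : Type u} [Field k] {ft : Prop}

instance (X : Sm k ft) (c : _root_.ConnectedComponents X.left) :
    ConnectedSpace (X.component c).left := by
  change ConnectedSpace (X.componentOpens c : Set X.left)
  obtain ⟨x, rfl⟩ := ConnectedComponents.surjective_coe c
  rw [← isConnected_iff_connectedSpace]
  change _root_.IsConnected (ConnectedComponents.mk ⁻¹' {_})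
  rw [connectedComponents_preimage_singleton]
  exact isConnected_connectedComponent

instance (X : Sm k ft) (c : _root_.ConnectedComponents X.left) :
    IsIntegral (X.component c).left := by
  have := (X.component c).isLocallyNoetherian
  exact isIntegral_of_isDomain_stalk _ fun x => Smooth.isDomain_stalk (X.component c).hom x

end Sm

/-! ### Free abelian groups -/

namespace FreeAbelianGroup

variable {α β γ : Type*}

lemma toFinsupp_map (f : α → β) (z : FreeAbelianGroup α) :
    toFinsupp (map f z) = Finsupp.mapDomain f (toFinsupp z) := by
  have : toFinsupp.comp (map f) = (Finsupp.mapDomain.addMonoidHom f).comp toFinsupp := by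
    ext x
    simp [map_of_apply]
  exact DFunLike.congr_fun this z

lemma map_injective {f : α → β} (hf : Function.Injective f) : Function.Injective (map f) := by
  intro z w h
  apply (equivFinsupp α).injective
  apply Finsupp.mapDomain_injective hf
  change Finsupp.mapDomain f (toFinsupp z) = Finsupp.mapDomain f (toFinsupp w)
  rw [← toFinsupp_map, h, toFinsupp_map]

/-- If the image of `z` under an injection `g` comes from `α`, so does the image of each
element of the support of `z`. -/
lemma mem_range_of_mem_support {g : β → γ} (hg : Function.Injective g) {f : α → γ}
    {z : FreeAbelianGroup β} {w : FreeAbelianGroup α} (h : map g z = map f w) {b : β}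
    (hb : b ∈ z.support) : g b ∈ Set.range f := by
  classical
  -- Injectivity of `g` excludes cancellation: the support of the image is the image of the support.
  have h1 : (Finsupp.mapDomain g (toFinsupp z)).support = (toFinsupp z).support.image g :=
    Finsupp.mapDomain_support_of_injective hg _
  rw [← toFinsupp_map, h, toFinsupp_map] at h1
  have h2 : g b ∈ (Finsupp.mapDomain f (toFinsupp w)).support :=
    h1 ▸ Finset.mem_image_of_mem g hb
  obtain ⟨a, -, ha⟩ := Finset.mem_image.mp (Finsupp.mapDomain_support h2)
  exact ⟨a, ha⟩

lemma exists_map_eq {f : α → β} (z : FreeAbelianGroup β) (h : ∀ b ∈ z.support, b ∈ Set.range f) :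
    ∃ w, map f w = z := by
  have : z ∈ (map f).range := by
    rw [← Finsupp.toFreeAbelianGroup_toFinsupp z, Finsupp.toFreeAbelianGroup,
      Finsupp.liftAddHom_apply]
    refine AddSubgroup.sum_mem _ fun b hb => ?_
    obtain ⟨a, rfl⟩ := h b hb
    exact ⟨(toFinsupp z (f a)) • of a, by rw [map_zsmul, map_of_apply]; rfl⟩
  exact this

end FreeAbelianGroup

/-! ### Pullback of formal sums of units -/

namespace AlgebraicGeometry.Scheme.Hom

variable {X Y Z : Scheme.{u}}

/-- The pullback of units along a morphism of schemes. -/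
def pullUnits (f : X ⟶ Y) : Γ(Y, ⊤)ˣ →* Γ(X, ⊤)ˣ := Units.map f.appTop.hom.toMonoidHom

/-- The pullback of formal sums of units along a morphism of schemes. -/
def pullSum (f : X ⟶ Y) : FreeAbelianGroup Γ(Y, ⊤)ˣ →+ FreeAbelianGroup Γ(X, ⊤)ˣ :=
  FreeAbelianGroup.map f.pullUnits

lemma pullUnits_comp (f : X ⟶ Y) (g : Y ⟶ Z) (a : Γ(Z, ⊤)ˣ) :
    (f ≫ g).pullUnits a = f.pullUnits (g.pullUnits a) := by
  ext
  change (f ≫ g).appTop.hom _ = _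
  rw [Scheme.Hom.comp_appTop]
  rfl

lemma pullSum_comp (f : X ⟶ Y) (g : Y ⟶ Z) (s : FreeAbelianGroup Γ(Z, ⊤)ˣ) :
    (f ≫ g).pullSum s = f.pullSum (g.pullSum s) := by
  have : ⇑(f ≫ g).pullUnits = f.pullUnits ∘ g.pullUnits := funext (pullUnits_comp f g)
  rw [pullSum, this, FreeAbelianGroup.map_comp_apply]
  rfl

end AlgebraicGeometry.Scheme.Hom

/-! ### Componentwise sections as families of formal sums of units -/

namespace Sm

variable {k : Type u} [Field k] {ft : Prop}

/-- Componentwise sections of `ℤ[𝔾ₘ]`. -/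
abbrev Sections (X : Sm k ft) : Type u :=
  ∀ c : _root_.ConnectedComponents X.left, FreeAbelianGroup Γ((X.component c).left, ⊤)ˣ

/-- The restriction of componentwise sections of `ℤ[𝔾ₘ]`. -/
noncomputable def Sections.map {X Y : Sm k ft} (f : Y ⟶ X) (s : X.Sections) : Y.Sections :=
  fun d => (componentMap f d).left.pullSum (s (mapComponents f d))

instance (X : Sm k ft) (c : _root_.ConnectedComponents X.left) :
    IsOpenImmersion (X.componentι c).left :=
  inferInstanceAs (IsOpenImmersion (X.componentOpens c).ι)

lemma range_componentι (X : Sm k ft) (c : _root_.ConnectedComponents X.left) :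
    Set.range (X.componentι c).left = ConnectedComponents.mk ⁻¹' {c} :=
  (X.componentOpens c).range_ι

/-! ### Evaluation of componentwise sections at connected schemes over `X` -/

section

variable {T T' : Scheme.{u}} [ConnectedSpace T] [ConnectedSpace T']

/-- The connected component of `X` that contains the image of a connected scheme. -/
noncomputable def componentOf {X : Sm k ft} (x : T ⟶ X.left) :
    _root_.ConnectedComponents X.left :=
  ConnectedComponents.mk (x (Classical.arbitrary T))

lemma mk_apply_eq_componentOf {X : Sm k ft} (x : T ⟶ X.left) (t : T) :
    ConnectedComponents.mk (x t) = componentOf x := by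
  rw [componentOf, ConnectedComponents.coe_eq_coe']
  exact (isPreconnected_range x.continuous).subset_connectedComponent ⟨_, rfl⟩ ⟨_, rfl⟩

/-- A morphism from a connected scheme factors through a connected component. -/
noncomputable def componentLift {X : Sm k ft} (x : T ⟶ X.left) :
    T ⟶ (X.component (componentOf x)).left :=
  IsOpenImmersion.lift (X.componentι (componentOf x)).left x (by
    rw [range_componentι]
    rintro _ ⟨t, rfl⟩
    exact mk_apply_eq_componentOf x t)

lemma componentLift_ι {X : Sm k ft} (x : T ⟶ X.left) :
    componentLift x ≫ (X.componentι (componentOf x)).left = x :=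
  IsOpenImmersion.lift_fac _ _ _

/-- The value of a componentwise section of `ℤ[𝔾ₘ]` at a connected scheme over `X`. -/
noncomputable def ev {X : Sm k ft} (x : T ⟶ X.left) (s : X.Sections) :
    FreeAbelianGroup Γ(T, ⊤)ˣ :=
  (componentLift x).pullSum (s (componentOf x))

lemma componentOf_comp_ι {X : Sm k ft} {c : _root_.ConnectedComponents X.left}
    (y : T ⟶ (X.component c).left) : componentOf (y ≫ (X.componentι c).left) = c :=
  (y (Classical.arbitrary T)).2

lemma ev_comp_ι {X : Sm k ft} (s : X.Sections)
    {c : _root_.ConnectedComponents X.left} (y : T ⟶ (X.component c).left) :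
    ev (y ≫ (X.componentι c).left) s = y.pullSum (s c) := by
  -- The component is generalized because `s c'` and the lift both have types depending on it.
  have key : ∀ (c' : _root_.ConnectedComponents X.left) (_ : c' = c)
      (z : T ⟶ (X.component c').left),
      z ≫ (X.componentι c').left = y ≫ (X.componentι c).left →
        z.pullSum (s c') = y.pullSum (s c) := by
    rintro _ rfl z hz
    have : z = y := (cancel_mono (X.componentι _).left).mp hz
    rw [this]
  exact key _ (componentOf_comp_ι y) _ (componentLift_ι _)

lemma ev_map {X Y : Sm k ft} (f : Y ⟶ X) (y : T ⟶ Y.left)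
    (s : X.Sections) :
    ev y (Sections.map f s) = ev (y ≫ f.left) s := by
  have : y ≫ f.left = (componentLift y ≫ (componentMap f (componentOf y)).left) ≫
      (X.componentι (mapComponents f (componentOf y))).left := by
    have h := congr($(componentMap_ι f (componentOf y)).left)
    change _ ≫ _ = _ ≫ _ at h
    rw [Category.assoc, h, ← Category.assoc, componentLift_ι]
  rw [this, ev_comp_ι, Scheme.Hom.pullSum_comp]
  rfl

lemma ev_comp {X : Sm k ft} (h : T' ⟶ T) (x : T ⟶ X.left)
    (s : X.Sections) : ev (h ≫ x) s = h.pullSum (ev x s) := by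
  have : h ≫ x = (h ≫ componentLift x) ≫ (X.componentι (componentOf x)).left := by
    rw [Category.assoc, componentLift_ι]
  rw [this, ev_comp_ι, Scheme.Hom.pullSum_comp]
  rfl

end

/-! ### Generic points -/

/-- The generic point of a connected component of `X`. -/
noncomputable def genericι (X : Sm k ft) (c : _root_.ConnectedComponents X.left) :
    Spec (X.component c).left.functionField ⟶ (X.component c).left :=
  (X.component c).left.fromSpecStalk _

/-- Functions on an integral scheme are determined by their value at the generic point. -/
lemma fromSpecStalk_appTop_injective (X : Scheme.{u}) [IsIntegral X] (x : X) :
    Function.Injective (X.fromSpecStalk x).appTop.hom := by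
  rw [Scheme.fromSpecStalk_appTop]
  have : Function.Injective (X.presheaf.germ ⊤ x trivial).hom :=
    germ_injective_of_isIntegral X (U := ⊤) x trivial
  exact (((Scheme.ΓSpecIso _).symm.commRingCatIsoToRingEquiv).injective).comp this

lemma pullUnits_injective {X Y : Scheme.{u}} {f : X ⟶ Y} (hf : Function.Injective f.appTop.hom) :
    Function.Injective f.pullUnits := Units.map_injective hf

lemma pullSum_genericι_injective (X : Sm k ft) (c : _root_.ConnectedComponents X.left) :
    Function.Injective (X.genericι c).pullSum :=
  FreeAbelianGroup.map_injective (pullUnits_injective (fromSpecStalk_appTop_injective _ _))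

/-- Componentwise sections are determined by their values at the generic points. -/
lemma ext_of_ev {X : Sm k ft} {s t : X.Sections}
    (h : ∀ c, ev (X.genericι c ≫ (X.componentι c).left) s =
      ev (X.genericι c ≫ (X.componentι c).left) t) : s = t := by
  funext c
  apply pullSum_genericι_injective X c
  rw [← ev_comp_ι, h, ev_comp_ι]

/-! ### Lifting along coverings -/

/-- Field valued points lift along Nisnevich coverings. -/
lemma IsNisnevichCovering.exists_lift {X : Sm k ft} {S : Sieve X} (hS : IsNisnevichCovering S)
    {L : CommRingCat.{u}} (hL : IsField L) (x : Spec L ⟶ X.left) :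
    ∃ (U : Sm k ft) (f : U ⟶ X) (p : Spec L ⟶ U.left),
      S f ∧ Etale f.left ∧ p ≫ f.left = x := by
  let := hL.toField
  have hx := X.left.descResidueField_stalkClosedPointTo_fromSpecResidueField L x
  set y := x (IsLocalRing.closedPoint L)
  obtain ⟨U, f, z, hf, hfe, hz, hi⟩ := hS y
  -- The point `x` factors through `Spec κ(y)`, and `κ(y) ≅ κ(z)` carries it to `U`.
  refine ⟨U, f, Spec.map (inv (f.left.residueFieldMap z) ≫ (X.left.residueFieldCongr hz).hom ≫
    X.left.descResidueField (Scheme.stalkClosedPointTo x)) ≫ U.left.fromSpecResidueField z,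
    hf, hfe, ?_⟩
  rw [Category.assoc, ← Scheme.Hom.SpecMap_residueFieldMap_fromSpecResidueField,
    ← Spec.map_comp_assoc]
  simpa [Spec.map_comp] using hx

/-- Étale morphisms in `Sm/k` can be base changed. -/
lemma exists_pullback {X U W : Sm k ft} (f : U ⟶ X) (g : W ⟶ X) [Etale f.left] {T : Scheme.{u}}
    (p : T ⟶ U.left) (q : T ⟶ W.left) (h : p ≫ f.left = q ≫ g.left) :
    ∃ (Z : Sm k ft) (a : Z ⟶ U) (b : Z ⟶ W) (l : T ⟶ Z.left),
      a ≫ f = b ≫ g ∧ l ≫ a.left = p ∧ l ≫ b.left = q := by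
  have hsep : IsSeparated f.left := by
    have : IsSeparated (f.left ≫ X.hom) := by
      rw [MorphismProperty.Over.w]; infer_instance
    exact IsSeparated.of_comp f.left X.hom
  have hqc : ft → QuasiCompact f.left := fun h => by
    have : QuasiCompact (f.left ≫ X.hom) := by
      rw [MorphismProperty.Over.w]; exact U.prop.2.2 h
    exact QuasiCompact.of_comp f.left X.hom
  let P : Sm k ft := MorphismProperty.Over.mk ⊤ (Limits.pullback.snd f.left g.left ≫ W.hom)
    ⟨inferInstance, inferInstance, fun h => by
      have := hqc h
      have : QuasiCompact W.hom := W.prop.2.2 h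
      infer_instance⟩
  refine ⟨P, MorphismProperty.Over.homMk (Limits.pullback.fst f.left g.left) ?_ trivial,
    MorphismProperty.Over.homMk (Limits.pullback.snd f.left g.left) rfl trivial,
    Limits.pullback.lift p q h, ?_, Limits.pullback.lift_fst _ _ _, Limits.pullback.lift_snd _ _ _⟩
  · change _ = Limits.pullback.snd f.left g.left ≫ W.hom
    calc _ = Limits.pullback.fst f.left g.left ≫ f.left ≫ X.hom := by
          rw [MorphismProperty.Over.w f]; rfl
      _ = Limits.pullback.snd f.left g.left ≫ g.left ≫ X.hom := by
          rw [Limits.pullback.condition_assoc]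
      _ = _ := by rw [MorphismProperty.Over.w g]
  · ext1
    exact Limits.pullback.condition

end Sm

/-! ### Extension of rational functions along flat morphisms -/

namespace AlgebraicGeometry

/-- Generalizations lift along flat morphisms, and the generic point of `W` has no proper
generalization. -/
lemma Flat.apply_genericPoint {W X : Scheme.{u}} [IrreducibleSpace W] [IrreducibleSpace X]
    (f : W ⟶ X) [Flat f] : f (genericPoint W) = genericPoint X := by
  obtain ⟨w, hw, hfw⟩ := Flat.generalizingMap f
    (show genericPoint X ⤳ f (genericPoint W) from (genericPoint_spec X).specializes trivial)
  have h : genericPoint W ⤳ w := (genericPoint_spec W).specializes trivial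
  rw [← hfw, (h.antisymm hw).eq]

/-- The map of function fields induced by a flat morphism of integral schemes. -/
noncomputable def functionFieldMap {W X : Scheme.{u}} [IrreducibleSpace W] [IrreducibleSpace X]
    (f : W ⟶ X) [Flat f] : X.functionField ⟶ W.functionField :=
  X.presheaf.stalkSpecializes (specializes_of_eq (Flat.apply_genericPoint f)) ≫
    f.stalkMap (genericPoint W)

lemma SpecMap_functionFieldMap_fromSpecStalk {W X : Scheme.{u}} [IrreducibleSpace W]
    [IrreducibleSpace X] (f : W ⟶ X) [Flat f] :
    Spec.map (functionFieldMap f) ≫ X.fromSpecStalk (genericPoint X) =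
      W.fromSpecStalk (genericPoint W) ≫ f := by
  rw [functionFieldMap, Spec.map_comp, Category.assoc,
    Scheme.SpecMap_stalkSpecializes_fromSpecStalk, Scheme.SpecMap_stalkMap_fromSpecStalk]

lemma functionFieldMap_algebraMap {W X : Scheme.{u}} [IrreducibleSpace W] [IrreducibleSpace X]
    (f : W ⟶ X) [Flat f] (w : W) (r : X.presheaf.stalk (f w)) :
    functionFieldMap f (algebraMap (X.presheaf.stalk (f w)) X.functionField r) =
      algebraMap (W.presheaf.stalk w) W.functionField (f.stalkMap w r) := by
  have h : genericPoint W ⤳ w := (genericPoint_spec W).specializes trivial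
  have key : X.presheaf.stalkSpecializes ((genericPoint_spec X).specializes trivial) ≫
      functionFieldMap f = f.stalkMap w ≫ W.presheaf.stalkSpecializes h := by
    rw [← Scheme.Hom.stalkSpecializes_stalkMap f _ _ h, functionFieldMap,
      TopCat.Presheaf.stalkSpecializes_comp_assoc]
  exact congr($key r)

/-- A rational function on `X` is regular at `f w` if its pullback along the flat morphism `f` is
regular at `w`. -/
lemma exists_algebraMap_stalk_eq {W X : Scheme.{u}} [IsIntegral W] [IsIntegral X]
    (f : W ⟶ X) [Flat f] (w : W) (a : X.functionField) (b : W.presheaf.stalk w)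
    (h : functionFieldMap f a = algebraMap (W.presheaf.stalk w) W.functionField b) :
    ∃ r : X.presheaf.stalk (f w), algebraMap _ X.functionField r = a := by
  obtain ⟨p, q, hq, rfl⟩ := IsFractionRing.div_surjective (X.presheaf.stalk (f w)) a
  have hq0 : algebraMap _ X.functionField q ≠ 0 :=
    IsFractionRing.to_map_ne_zero_of_mem_nonZeroDivisors hq
  -- A flat local homomorphism is faithfully flat, so ideals are contracted from their extensions.
  -- For `a = p / q`, divisibility of `p` by `q` therefore descends from the stalk at `w`.
  algebraize [(f.stalkMap w).hom]
  have : Module.Flat (X.presheaf.stalk (f w)) (W.presheaf.stalk w) := Flat.stalkMap f w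
  have : IsLocalHom (algebraMap (X.presheaf.stalk (f w)) (W.presheaf.stalk w)) :=
    inferInstanceAs (IsLocalHom (f.stalkMap w).hom)
  have := Module.FaithfullyFlat.of_flat_of_isLocalHom (A := X.presheaf.stalk (f w))
    (B := W.presheaf.stalk w)
  have hp : f.stalkMap w p = f.stalkMap w q * b := by
    apply IsFractionRing.injective (W.presheaf.stalk w) W.functionField
    rw [map_mul, ← h, ← functionFieldMap_algebraMap, ← functionFieldMap_algebraMap, ← map_mul,
      mul_div_cancel₀ _ hq0]
  have hmem : p ∈ (Ideal.map (algebraMap _ (W.presheaf.stalk w)) (Ideal.span {q})).comap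
      (algebraMap (X.presheaf.stalk (f w)) (W.presheaf.stalk w)) := by
    rw [Ideal.mem_comap, Ideal.map_span, Set.image_singleton, Ideal.mem_span_singleton]
    exact ⟨b, hp⟩
  rw [Ideal.comap_map_eq_self_of_faithfullyFlat, Ideal.mem_span_singleton] at hmem
  obtain ⟨r, rfl⟩ := hmem
  exact ⟨r, by rw [map_mul, mul_div_cancel_left₀ _ hq0]⟩

/-- A rational function on an integral scheme that is regular at every point is regular. -/
lemma exists_germToFunctionField_eq {X : Scheme.{u}} [IsIntegral X] (a : X.functionField)
    (h : ∀ x : X, ∃ r : X.presheaf.stalk x, algebraMap _ X.functionField r = a) :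
    ∃ α : Γ(X, ⊤), X.presheaf.germ ⊤ (genericPoint X) trivial α = a := by
  have (x : X) : ∃ (U : X.Opens) (_ : x ∈ U) (hU : genericPoint X ∈ U) (s : Γ(X, U)),
      X.presheaf.germ U (genericPoint X) hU s = a := by
    obtain ⟨r, hr⟩ := h x
    obtain ⟨U, hxU, s, rfl⟩ := X.presheaf.exists_germ_eq r
    refine ⟨U, hxU, ((genericPoint_spec X).specializes trivial).mem_open U.isOpen hxU, s, ?_⟩
    rw [← hr]
    exact (X.presheaf.germ_stalkSpecializes_apply _ _ _).symm
  choose U hxU hU s hs using this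
  obtain ⟨α, hα, -⟩ := X.sheaf.existsUnique_gluing' U ⊤ (fun x => homOfLE le_top)
    (fun x _ => TopologicalSpace.Opens.mem_iSup.mpr ⟨x, hxU x⟩) s (by
      intro x y
      -- The generic point lies in every overlap, and all the local sections have germ `a` there.
      apply germ_injective_of_isIntegral X (U := U x ⊓ U y) (genericPoint X) ⟨hU x, hU y⟩
      refine (X.presheaf.germ_res_apply _ _ _ _).trans (.trans ?_
        (X.presheaf.germ_res_apply _ _ _ _).symm)
      exact (hs x).trans (hs y).symm)
  refine ⟨α, ?_⟩
  let x := genericPoint X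
  rw [← hs x, ← hα x]
  exact (X.presheaf.germ_res_apply (homOfLE le_top : U x ⟶ ⊤) _ _ _).symm

lemma exists_appTop_eq {X : Scheme.{u}} [IsIntegral X] (a : Γ(Spec X.functionField, ⊤))
    (h : ∀ x : X, ∃ (W : Scheme.{u}) (_ : IsIntegral W) (f : W ⟶ X) (_ : Flat f) (w : W)
      (b : Γ(W, ⊤)), f w = x ∧ (Spec.map (functionFieldMap f)).appTop a =
        (W.fromSpecStalk (genericPoint W)).appTop b) :
    ∃ α : Γ(X, ⊤), (X.fromSpecStalk (genericPoint X)).appTop α = a := by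
  have key (Y : Scheme.{u}) (y : Y) (b : Γ(Y, ⊤)) :
      (Scheme.ΓSpecIso (Y.presheaf.stalk y)).hom ((Y.fromSpecStalk y).appTop b) =
        Y.presheaf.germ ⊤ y trivial b := by
    have : (Y.fromSpecStalk y).appTop ≫ (Scheme.ΓSpecIso (Y.presheaf.stalk y)).hom =
        Y.presheaf.germ ⊤ y trivial := by
      rw [Scheme.fromSpecStalk_appTop]
      simp
    exact congr($this b)
  have inj (R : CommRingCat.{u}) : Function.Injective (Scheme.ΓSpecIso R).hom :=
    (Scheme.ΓSpecIso R).commRingCatIsoToRingEquiv.injective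
  obtain ⟨α, hα⟩ := exists_germToFunctionField_eq ((Scheme.ΓSpecIso X.functionField).hom a) (by
    intro x
    obtain ⟨W, _, f, _, w, b, rfl, hb⟩ := h x
    refine exists_algebraMap_stalk_eq f w _ (W.presheaf.germ ⊤ w trivial b) ?_
    have h1 := congr($(Scheme.ΓSpecIso_naturality (functionFieldMap f)) a)
    rw [CommRingCat.comp_apply, CommRingCat.comp_apply, hb] at h1
    rw [← h1, key]
    exact (W.presheaf.germ_stalkSpecializes_apply _ _ _).symm)
  exact ⟨α, inj _ (by rw [key, hα])⟩

/-- A rational unit on an integral scheme `X` is a unit of `X` if it becomes one after pullback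
to a family of integral schemes, flat over `X`, that covers `X`. -/
lemma exists_pullUnits_eq {X : Scheme.{u}} [IsIntegral X] (a : Γ(Spec X.functionField, ⊤)ˣ)
    (h : ∀ x : X, ∃ (W : Scheme.{u}) (_ : IsIntegral W) (f : W ⟶ X) (_ : Flat f) (w : W)
      (b : Γ(W, ⊤)ˣ), f w = x ∧ (Spec.map (functionFieldMap f)).pullUnits a =
        (W.fromSpecStalk (genericPoint W)).pullUnits b) :
    ∃ α : Γ(X, ⊤)ˣ, (X.fromSpecStalk (genericPoint X)).pullUnits α = a := by
  obtain ⟨α, hα⟩ := exists_appTop_eq (a : Γ(Spec X.functionField, ⊤)) fun x => by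
    obtain ⟨W, hW, f, hf, w, b, hw, hb⟩ := h x
    exact ⟨W, hW, f, hf, w, b, hw, congr(($hb : Γ(Spec W.functionField, ⊤)))⟩
  -- Regularity of `a` alone would not give a unit; the inverse is extended separately.
  obtain ⟨β, hβ⟩ := exists_appTop_eq
      ((a⁻¹ : Γ(Spec X.functionField, ⊤)ˣ) : Γ(Spec X.functionField, ⊤)) fun x => by
    obtain ⟨W, hW, f, hf, w, b, hw, hb⟩ := h x
    refine ⟨W, hW, f, hf, w, (b⁻¹ : Γ(W, ⊤)ˣ), hw, ?_⟩
    have := congr($hb⁻¹)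
    rw [← map_inv, ← map_inv] at this
    exact congr(($this : Γ(Spec W.functionField, ⊤)))
  have hαβ : α * β = 1 := by
    apply Sm.fromSpecStalk_appTop_injective X (genericPoint X)
    change (X.fromSpecStalk (genericPoint X)).appTop _ = (X.fromSpecStalk (genericPoint X)).appTop _
    rw [map_mul, map_one, hα, hβ, Units.mul_inv]
  exact ⟨⟨α, β, hαβ, by rw [mul_comm, hαβ]⟩, Units.ext hα⟩

end AlgebraicGeometry

namespace Sm

variable {k : Type u} [Field k] {ft : Prop}

/-! ### Gluing componentwise sections of `ℤ[𝔾ₘ]` -/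

lemma isField_functionField (X : Scheme.{u}) [IsIntegral X] : IsField X.functionField :=
  Field.toIsField X.functionField

lemma connectedSpace_Spec {L : CommRingCat.{u}} (hL : IsField L) : ConnectedSpace (Spec L) := by
  let := hL.toField
  exact inferInstanceAs (ConnectedSpace (PrimeSpectrum L))

instance (X : Scheme.{u}) [IsIntegral X] : ConnectedSpace (Spec X.functionField) :=
  connectedSpace_Spec (isField_functionField X)

lemma pullUnits_SpecMap_injective {X Y : Scheme.{u}} [IsIntegral X] [IsIntegral Y]
    (φ : X.functionField ⟶ Y.functionField) : Function.Injective (Spec.map φ).pullUnits := by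
  apply pullUnits_injective
  have h := Scheme.ΓSpecIso_naturality φ
  have : (Spec.map φ).appTop = (Scheme.ΓSpecIso _).hom ≫ φ ≫ (Scheme.ΓSpecIso _).inv := by
    rw [← Category.assoc, ← h, Category.assoc, Iso.hom_inv_id, Category.comp_id]
  rw [this]
  exact ((Scheme.ΓSpecIso _).symm.commRingCatIsoToRingEquiv.injective.comp
    (RingHom.injective φ.hom)).comp (Scheme.ΓSpecIso _).commRingCatIsoToRingEquiv.injective

lemma flat_componentMap {X W : Sm k ft} (g : W ⟶ X) [Etale g.left]
    (d : _root_.ConnectedComponents W.left) : Flat (componentMap g d).left := by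
  change Flat (g.left.resLE _ _ _)
  infer_instance

/-- Compatible families of componentwise sections of `ℤ[𝔾ₘ]` on a sieve. -/
structure CompatibleFamily {X : Sm k ft} (S : Sieve X) where
  /-- The sections of the family. -/
  sec {U : Sm k ft} (f : U ⟶ X) (hf : S f) : U.Sections
  compat {U V : Sm k ft} (f : U ⟶ X) (hf : S f) (g : V ⟶ U) :
    Sections.map g (sec f hf) = sec (g ≫ f) (S.downward_closed hf g)

section

variable {X : Sm k ft} {S : Sieve X}

/-- Both points factor through `U ×_X W`, which lies in `Sm/k` because `f` is étale, and
compatibility identifies the two restrictions there. The morphism `g` may be arbitrary, which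
matters for members of the sieve that are not étale. -/
lemma CompatibleFamily.ev_eq (s : CompatibleFamily S) {T : Scheme.{u}} [ConnectedSpace T]
    {U W : Sm k ft} (f : U ⟶ X) (hf : S f) [Etale f.left] (g : W ⟶ X) (hg : S g)
    (p : T ⟶ U.left) (q : T ⟶ W.left) (h : p ≫ f.left = q ≫ g.left) :
    ev p (s.sec f hf) = ev q (s.sec g hg) := by
  obtain ⟨Z, a, b, l, hab, rfl, rfl⟩ := exists_pullback f g p q h
  rw [← ev_map, ← ev_map, s.compat, s.compat]
  congr 2

/-- Two componentwise sections that agree on a Nisnevich covering are equal. -/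
lemma IsNisnevichCovering.sections_ext (hS : IsNisnevichCovering S) {s t : X.Sections}
    (h : ∀ (U : Sm k ft) (f : U ⟶ X), S f → Sections.map f s = Sections.map f t) : s = t := by
  refine ext_of_ev fun c => ?_
  obtain ⟨U, f, p, hf, -, hp⟩ := hS.exists_lift (isField_functionField _)
    (X.genericι c ≫ (X.componentι c).left)
  have := congrArg (ev p) (h U f hf)
  rwa [ev_map, ev_map, hp] at this

/-- The value of a compatible family at the generic point of a component of `X` comes from that
component. -/
lemma CompatibleFamily.exists_component (s : CompatibleFamily S) (hS : IsNisnevichCovering S)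
    (c : _root_.ConnectedComponents X.left) :
    ∃ t : FreeAbelianGroup Γ((X.component c).left, ⊤)ˣ,
      ∀ (U : Sm k ft) (f : U ⟶ X) (hf : S f) (p : Spec (X.component c).left.functionField ⟶ U.left),
        p ≫ f.left = X.genericι c ≫ (X.componentι c).left →
          ev p (s.sec f hf) = (X.genericι c).pullSum t := by
  obtain ⟨U, f, p, hf, hfe, hp⟩ := hS.exists_lift (isField_functionField _)
    (X.genericι c ≫ (X.componentι c).left)
  obtain ⟨t, ht⟩ : ∃ t, (X.genericι c).pullSum t = ev p (s.sec f hf) := by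
    -- Descent is done for one unit `a` of the support at a time, near each point `x`.
    refine FreeAbelianGroup.exists_map_eq _ fun a ha => ?_
    refine exists_pullUnits_eq a fun x => ?_
    obtain ⟨W, g, w, hg, hge, hw, -⟩ := hS ((X.componentι c).left x)
    let d : _root_.ConnectedComponents W.left := ConnectedComponents.mk w
    have hc : mapComponents g d = c := by
      change ConnectedComponents.mk (g.left w) = c
      rw [hw]
      exact x.2
    subst hc
    let w' : (W.component d).left := ⟨w, rfl⟩
    have hflat := flat_componentMap g d
    have hsq := congr($(componentMap_ι g d).left)
    change (componentMap g d).left ≫ (X.componentι _).left = (W.componentι d).left ≫ g.left at hsq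
    have hgen := SpecMap_functionFieldMap_fromSpecStalk (componentMap g d).left
    -- By flatness the generic point of `W_d` lies over that of `X_c`, so it and the base change of
    -- `p` to `K(W_d)` are points over the same point of `X`.
    have key := s.ev_eq f hf g hg (Spec.map (functionFieldMap (componentMap g d).left) ≫ p)
      (W.genericι d ≫ (W.componentι d).left) (by
        rw [Category.assoc, hp, Category.assoc, ← hsq, ← Category.assoc, ← Category.assoc]
        exact congr($hgen ≫ _))
    rw [ev_comp, ev_comp_ι] at key
    obtain ⟨b, hb⟩ := FreeAbelianGroup.mem_range_of_mem_support
      (pullUnits_SpecMap_injective (functionFieldMap (componentMap g d).left)) key ha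
    refine ⟨_, inferInstance, (componentMap g d).left, hflat, w', b, ?_, hb.symm⟩
    apply (X.componentι _).left.isOpenEmbedding.injective
    rw [← hw, ← Scheme.Hom.comp_apply, hsq]
    rfl
  refine ⟨t, fun U' f' hf' p' hp' => ?_⟩
  rw [ht, s.ev_eq f hf f' hf' p p' (hp.trans hp'.symm)]

lemma CompatibleFamily.exists_glue (s : CompatibleFamily S) (hS : IsNisnevichCovering S) :
    ∃ t : X.Sections, ∀ (U : Sm k ft) (f : U ⟶ X) (hf : S f), Sections.map f t = s.sec f hf := by
  choose t ht using s.exists_component hS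
  -- For étale `g`, generic points of `W` map to generic points of components of `X`, where `t` was
  -- prescribed.
  have het {W : Sm k ft} (g : W ⟶ X) (hg : S g) [Etale g.left] : Sections.map g t = s.sec g hg := by
    refine ext_of_ev fun d => ?_
    have hflat := flat_componentMap g d
    have hsq := congr($(componentMap_ι g d).left)
    change (componentMap g d).left ≫ (X.componentι _).left = (W.componentι d).left ≫ g.left at hsq
    have hgen := SpecMap_functionFieldMap_fromSpecStalk (componentMap g d).left
    have h : (W.genericι d ≫ (W.componentι d).left) ≫ g.left =
        Spec.map (functionFieldMap (componentMap g d).left) ≫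
          X.genericι (mapComponents g d) ≫ (X.componentι (mapComponents g d)).left := by
      rw [Category.assoc, ← hsq, ← Category.assoc, ← Category.assoc]
      exact congr($hgen.symm ≫ _)
    obtain ⟨U, f, p, hf, hfe, hp⟩ := hS.exists_lift (isField_functionField _)
      (X.genericι (mapComponents g d) ≫ (X.componentι (mapComponents g d)).left)
    rw [ev_map, h, ev_comp, ev_comp_ι, ← ht _ U f hf p hp, ← ev_comp]
    exact s.ev_eq f hf g hg _ _ (by rw [Category.assoc, hp, h])
  refine ⟨t, fun W g hg => ext_of_ev fun d => ?_⟩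
  -- For general `g` the image of a generic point of `W` need not be generic in `X`. It is lifted to
  -- an étale member of the sieve, where the étale case applies.
  obtain ⟨U, f, p, hf, hfe, hp⟩ := hS.exists_lift (isField_functionField _)
    ((W.genericι d ≫ (W.componentι d).left) ≫ g.left)
  rw [ev_map, ← hp, ← ev_map, het f hf]
  exact s.ev_eq f hf g hg p _ hp

end

lemma isSheaf_componentwise_ZGm :
    Presheaf.IsSheaf (nisnevichTopology k ft) (componentwise (ZGm k ft)) := by
  intro E X S hS x hx
  replace hS : IsNisnevichCovering S := hS
  have hext {s t : X.Sections}
      (h : ∀ (U : Sm k ft) (f : U ⟶ X), S f → Sections.map f s = Sections.map f t) : s = t :=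
    hS.sections_ext h
  -- `Sections` unfolds to the values of `componentwise (ZGm k ft)`. Gluing is done for each element
  -- of the test group `E`; uniqueness makes the result additive.
  let fam (e : E) : CompatibleFamily S :=
    { sec f hf := (x f hf).hom e
      compat {U V} f hf g := by
        have := (Presieve.compatible_iff_sieveCompatible x).mp hx f g hf
        exact congr(($this).hom e).symm }
  choose t ht using fun e => (fam e).exists_glue hS
  let τ : E ⟶ (componentwise (ZGm k ft)).obj (op X) := AddCommGrpCat.ofHom
    { toFun := t
      map_zero' := hext fun U f hf => by
        refine (ht 0 U f hf).trans ?_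
        exact ((x f hf).hom.map_zero).trans
          ((componentwise (ZGm k ft)).map f.op).hom.map_zero.symm
      map_add' a b := hext fun U f hf => by
        refine (ht _ U f hf).trans ?_
        refine ((x f hf).hom.map_add a b).trans ?_
        refine .trans ?_ (((componentwise (ZGm k ft)).map f.op).hom.map_add (t a) (t b)).symm
        exact congr($((ht a U f hf).symm) + $((ht b U f hf).symm)) }
  refine ⟨τ, fun U f hf => ?_, fun τ' hτ' => ?_⟩
  · exact AddCommGrpCat.hom_ext (AddMonoidHom.ext fun e => ht e U f hf)
  · refine AddCommGrpCat.hom_ext (AddMonoidHom.ext fun e => ?_)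
    refine hext fun U f hf => .trans ?_ (ht e U f hf).symm
    exact congr(($(hτ' f hf)).hom e)

end Sm

namespace Sm

variable {k : Type u} [Field k] {ft : Prop}

/-! ### Sheaves of abelian groups and connected components -/

/-- The inclusions of the connected components form a Nisnevich covering. -/
lemma ofArrows_componentι_mem (X : Sm k ft) :
    Sieve.generate (Presieve.ofArrows X.component X.componentι) ∈ nisnevichTopology k ft X := by
  intro x
  let c : _root_.ConnectedComponents X.left := ConnectedComponents.mk x
  let z : (X.component c).left := (⟨x, rfl⟩ : X.componentOpens c)
  exact ⟨X.component c, X.componentι c, z,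
    Sieve.le_generate _ _ _ (Presieve.ofArrows.mk c),
    inferInstanceAs (Etale (X.componentOpens c).ι), rfl,
    inferInstanceAs (IsIso ((X.componentι c).left.residueFieldMap z))⟩

/-- A sheaf of abelian groups is trivial on the empty scheme. -/
lemma hom_ext_of_isEmpty {P : (Sm k ft)ᵒᵖ ⥤ AddCommGrpCat.{u}}
    (hP : Presheaf.IsSheaf (nisnevichTopology k ft) P) (Z : Sm k ft) [IsEmpty Z.left]
    {E : AddCommGrpCat.{u}} (f g : E ⟶ P.obj (op Z)) : f = g := by
  -- The empty sieve covers the empty scheme.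
  have h : (⊥ : Sieve Z) ∈ nisnevichTopology k ft Z := fun z => (IsEmpty.false z).elim
  exact (hP E _ h).isSeparatedFor.ext fun _ _ hf => hf.elim

/-- Sections of a sheaf of abelian groups are families of sections on the connected components. -/
lemma isIso_toComponentwise {P : (Sm k ft)ᵒᵖ ⥤ AddCommGrpCat.{u}}
    (hP : Presheaf.IsSheaf (nisnevichTopology k ft) P) : IsIso (toComponentwise P) := by
  have (X : (Sm k ft)ᵒᵖ) : IsIso ((toComponentwise P).app X) := by
    induction X using Opposite.rec with | op X
    have H (E : AddCommGrpCat.{u}) := (Presieve.isSheafFor_arrows_iff _ _).mp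
      ((Presieve.isSheafFor_iff_generate _).mpr (hP E _ X.ofArrows_componentι_mem))
    let π (c) : (componentwise P).obj (op X) ⟶ P.obj (op (X.component c)) :=
      AddCommGrpCat.ofHom (Pi.evalAddMonoidHom _ c)
    -- The inverse glues the projections: a nonempty `Z` over two components forces them to be
    -- equal, and over an empty `Z` there is nothing to check.
    obtain ⟨r, hr, -⟩ := H _ π (by
      intro c c' Z a b hab
      by_cases hZ : IsEmpty Z.left
      · exact hom_ext_of_isEmpty hP Z _ _
      · rw [not_isEmpty_iff] at hZ
        obtain ⟨z⟩ := hZ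
        have hc : c = c' := by
          have h1 : ConnectedComponents.mk ((X.componentι c).left (a.left z)) = c := (a.left z).2
          have h2 : ConnectedComponents.mk ((X.componentι c').left (b.left z)) = c' := (b.left z).2
          rw [← h1, ← h2]
          have h3 : a.left ≫ (X.componentι c).left = b.left ≫ (X.componentι c').left :=
            congr($(hab).left)
          exact congr(ConnectedComponents.mk ($h3 z))
        subst hc
        rw [(cancel_mono (X.componentι c)).mp hab])
    refine ⟨r, ?_, ?_⟩
    · exact (H _ (fun c => P.map (X.componentι c).op) (by
        intro c c' Z a b hab
        change _ ≫ P.map _ = _ ≫ P.map _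
        rw [← P.map_comp, ← P.map_comp, ← op_comp, ← op_comp, hab])).unique
        (fun c => by
          change (_ ≫ r) ≫ P.map _ = _
          rw [Category.assoc]
          refine (congr(_ ≫ $(hr c))).trans ?_
          rfl)
        (fun c => Category.id_comp (P.map (X.componentι c).op))
    · ext s
      funext c
      exact congr(($(hr c)).hom s)
  exact NatIso.isIso_of_isIso_app _

/-! ### The universal property -/

/-- Functoriality of `componentwise`. -/
noncomputable def componentwiseMap {P Q : (Sm k ft)ᵒᵖ ⥤ AddCommGrpCat.{u}} (φ : P ⟶ Q) :
    componentwise P ⟶ componentwise Q where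
  app X := AddCommGrpCat.ofHom
    { toFun s c := φ.app _ (s c)
      map_zero' := by ext c; simp
      map_add' s t := by ext c; simp }
  naturality X Y f := by
    ext s
    funext d
    exact congr($(φ.naturality (componentMap f.unop d).op) (s (mapComponents f.unop d)))

lemma toComponentwise_naturality {P Q : (Sm k ft)ᵒᵖ ⥤ AddCommGrpCat.{u}} (φ : P ⟶ Q) :
    toComponentwise P ≫ componentwiseMap φ = φ ≫ toComponentwise Q := by
  ext X s
  funext c
  exact congr($(φ.naturality (X.unop.componentι c).op) s)

/-- On a connected component, a componentwise section comes from a section. -/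
lemma componentwise_map_componentι (P : (Sm k ft)ᵒᵖ ⥤ AddCommGrpCat.{u}) (X : Sm k ft)
    (c : _root_.ConnectedComponents X.left) (s : (componentwise P).obj (op X)) :
    (componentwise P).map (X.componentι c).op s =
      (toComponentwise P).app (op (X.component c)) ((s : ∀ c, P.obj (op (X.component c))) c) := by
  funext d
  have hd : mapComponents (X.componentι c) d = c := by
    obtain ⟨x, rfl⟩ := ConnectedComponents.surjective_coe d
    exact x.2
  exact map_component_congr P ((X.component c).componentι d ≫ X.componentι c)
    (s : ∀ c, P.obj (op (X.component c))) hd _ _ (componentMap_ι _ _) rfl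

/-- By naturality along `X_c → X`, the restriction of `ψ s` to `X_c` is `ψ` of a section in the
image of `toComponentwise P`. This gives uniqueness: when `toComponentwise Q` is invertible, `ψ` is
determined by `toComponentwise P ≫ ψ`. -/
lemma comp_toComponentwise_eq {P Q : (Sm k ft)ᵒᵖ ⥤ AddCommGrpCat.{u}} (ψ : componentwise P ⟶ Q) :
    ψ ≫ toComponentwise Q = componentwiseMap (toComponentwise P ≫ ψ) := by
  ext X s
  funext c
  have h := congr($(ψ.naturality (X.unop.componentι c).op) s)
  refine h.symm.trans ?_
  exact congr(ψ.app _ $(componentwise_map_componentι P X.unop c s))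

lemma isSheafification_toComponentwise {P : (Sm k ft)ᵒᵖ ⥤ AddCommGrpCat.{u}}
    (h : Presheaf.IsSheaf (nisnevichTopology k ft) (componentwise P)) :
    IsSheafification (nisnevichTopology k ft) (toComponentwise P) where
  isSheaf := h
  existsUnique S hS φ := by
    have := isIso_toComponentwise hS
    refine ⟨componentwiseMap φ ≫ inv (toComponentwise S), ?_, fun ψ hψ => ?_⟩
    · simp only [← Category.assoc, toComponentwise_naturality]
      simp
    · rw [IsIso.eq_comp_inv, comp_toComponentwise_eq, hψ]

end Sm

theorem mainTheorem6 (k : Type u) [Field k] (ft : Prop) :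
    IsSheafification (Sm.nisnevichTopology k ft) (Sm.toComponentwise (Sm.ZGm k ft)) :=
  Sm.isSheafification_toComponentwise Sm.isSheaf_componentwise_ZGm
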